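/- \textbf{Setting.} Let $(M,g)$ be a four-dimensional time-oriented smooth manifold with a smooth Lorentzian metric $g$ of signature $(-,+,+,+)$ and a smooth linear connection $\nabla$ preserving $g$ (possibly with torsion). Let $S(0)\subset M$ be a connected embedded smooth spacelike hypersurface, $D\subseteq S(0)$ an open domain, and let $m=\Phi(x,t)$ be a Gaussian chart over $D$: $\Phi$ is a diffeomorphism of $D\times\mathbb R$ onto an open region $\Omega\subseteq M$, $\Phi(x,0)=x$, and the curves $t\mapsto\Phi(x,t)$ are the integral curves of a smooth vector field $n$ on $\Omega$ which on $D$ is the future-oriented normal of $S(0)$ with $g(n,n)=-1$ and which satisfies $\nabla_n n=0$ (the curves are geodesics). The variables form a complex vector space $E$ of sections over $\Omega$ of a complex vector bundle trivialized over $\Omega$. An observer whose time coordinate is translated by $\theta\in\mathbb R$ uses the chart $(x,t)\mapsto\Phi(x,t-\theta)$; reporting the components he reads in the chart of the reference observer ($\theta=0$) gives the gauge transformation $(U(\theta)X)(x,t)=X(x,t-\theta)$. All these observers use the same model: (a) $U(\theta)E\subseteq E$ for all $\theta$; (b) there are a complex Hilbert space $H$ and an injective linear map $\Upsilon:E\to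 H$ with dense range; $E$ carries the inner product (positive kernel) $K(X,Y)=\langle\Upsilon X,\Upsilon Y\rangle_H$; (c) there is a set $H_0\subseteq H$ of states, and to each state $\psi\in H_0$ the observer $\theta$ assigns a measure $X_\theta(\psi)\in E$, with $X_\theta(\psi)=U(\theta)X_0(\psi)$ and $K(X_\theta(\psi_1),X_\theta(\psi_2))=\langle\psi_1,\psi_2\rangle_H$ for every $\theta\in\mathbb R$ and all $\psi_1,\psi_2\in H_0$; the vectors $X_0(\psi)$, $\psi\in H_0$, span $E$; (d) for every $X\in E$, $U(\theta)X\to X$ as $\theta\to0$ in the norm defined by $K$. The evolution of the system with variables $X\in E$ is the map $\psi:\mathbb R\to H$, $\psi(t)=\Upsilon(U(t)X)$. \textbf{Proposition 22 (translation in time, General Relativity).} Let $\hbar>0$ be any fixed constant, the same for all systems. There are unitary operators $\widehat U(\theta)$ on $H$, $\theta\in\mathbb R$, with $\widehat U(\theta)\circ\Upsilon=\Upsilon\circ U(\theta)$, which form a strongly continuous one-parameter group ($\widehat U(0)=\mathrm{Id}$, $\widehat U(\theta+\theta')=\widehat U(\theta)\widehat U(\theta')$), and there is a (possibly unbounded)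 self-adjoint operator $\mathcal H$ on $H$ such that $$\widehat U(t)=\exp\Big(\frac{t}{i\hbar}\mathcal H\Big)\quad(t\in\mathbb R),$$ and the evolution of the system with any variables $X\in E$ is $\psi(t)=\widehat U(t)\psi(0)$. Moreover the Schr\"odinger equation holds: if $\psi_0$ is in the domain of $\mathcal H$ and $\psi(t)=\widehat U(t)\psi_0$, then for every $t$ the vector $\psi(t)$ is in the domain of $\mathcal H$, $\psi$ is differentiable at $t$, and $i\hbar\,\frac{d\psi}{dt}(t)=\mathcal H\psi(t)$. Here, for a self-adjoint $\mathcal H$ and $z\in i\mathbb R$, $\exp(z\mathcal H)\psi=\lim_{k\to\infty}\exp(z\mathcal H_k)\psi$ with the bounded operators $\mathcal H_k=k^2\mathcal H(\mathcal H^2+k^2)^{-1}$, $k=1,2,\dots$ (this agrees with the exponential defined by the spectral theorem). -/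

import Mathlib

open Bundle Filter Topology
open scoped Manifold ContDiff InnerProductSpace

noncomputable section

namespace TimeTranslation

/-! ## Exponential of an unbounded operator -/

section Exponential

variable {H : Type*} [NormedAddCommGroup H] [InnerProductSpace ℂ H]

/-- `R` is the bounded, everywhere defined inverse of `A - z`. -/
def IsResolvent (A : H →ₗ.[ℂ] H) (z : ℂ) (R : H →L[ℂ] H) : Prop :=
  (∀ x : H, ∃ h : R x ∈ A.domain, A ⟨R x, h⟩ - z • R x = x) ∧
    ∀ y : A.domain, R (A y - z • (y : H)) = y

/-- The bounded truncation `k² A (A² + k²)⁻¹ = (k²/2) ((A - ik)⁻¹ + (A + ik)⁻¹)` of `A`, written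
through the resolvents `R = (A - ik)⁻¹` and `R' = (A + ik)⁻¹`. -/
def truncation (k : ℂ) (R R' : H →L[ℂ] H) : H →L[ℂ] H :=
  (k ^ 2 / 2) • (R + R')

/-- `T = exp (z A)` for an operator `A` that need not be bounded: `T ψ` is the limit, as `k → ∞`, of
`exp (z Aₖ) ψ`, where `Aₖ = k² A (A² + k²)⁻¹` are the bounded truncations of `A` (`Aₖ ψ → A ψ` on
the domain of a self-adjoint `A`) and the exponential of a bounded operator is the sum of its
power series. -/
def IsExp (A : H →ₗ.[ℂ] H) (z : ℂ) (T : H →L[ℂ] H) : Prop :=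
  ∃ R R' : ℕ → H →L[ℂ] H,
    (∀ n : ℕ, IsResolvent A (Complex.I * (n + 1)) (R n)) ∧
    (∀ n : ℕ, IsResolvent A (-(Complex.I * (n + 1))) (R' n)) ∧
    ∀ ψ : H, Tendsto
      (fun n : ℕ => NormedSpace.exp (z • truncation ((n : ℂ) + 1) (R n) (R' n)) ψ)
      atTop (𝓝 (T ψ))

end Exponential

/-! ## Spacetime and Gaussian charts -/

section Geometry

/-- The geometry of the universe: a Lorentzian metric of signature `(-,+,+,+)` on a four dimensional
manifold, a time orientation, and a linear connection that preserves the metric (its torsion is not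
required to vanish, the Levi-Civita connection being the torsion free case). -/
structure Spacetime (M : Type*) [TopologicalSpace M]
    [ChartedSpace (EuclideanSpace ℝ (Fin 4)) M] [IsManifold (𝓡 4) ∞ M] where
  /-- the metric tensor -/
  metric : ∀ m : M, TangentSpace (𝓡 4) m →L[ℝ] TangentSpace (𝓡 4) m →L[ℝ] ℝ
  metric_symm : ∀ (m : M) (u v : TangentSpace (𝓡 4) m), metric m u v = metric m v u
  metric_smooth :
    ContMDiff (𝓡 4)
      ((𝓡 4).prod 𝓘(ℝ, EuclideanSpace ℝ (Fin 4) →L[ℝ] EuclideanSpace ℝ (Fin 4) →L[ℝ] ℝ)) ∞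
      (fun m : M => TotalSpace.mk'
        (EuclideanSpace ℝ (Fin 4) →L[ℝ] EuclideanSpace ℝ (Fin 4) →L[ℝ] ℝ)
        (E := fun m : M => TangentSpace (𝓡 4) m →L[ℝ] TangentSpace (𝓡 4) m →L[ℝ] ℝ)
        m (metric m))
  metric_signature : ∀ m : M, ∃ b : Module.Basis (Fin 4) ℝ (TangentSpace (𝓡 4) m),
    ∀ i j, metric m (b i) (b j) = if i = j then (if i = 0 then -1 else 1) else 0
  /-- a continuous timelike vector field that gives the time orientation -/
  timeDirection : ∀ m : M, TangentSpace (𝓡 4) m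
  timeDirection_continuous :
    Continuous (fun m : M => (⟨m, timeDirection m⟩ : TangentBundle (𝓡 4) M))
  timeDirection_timelike : ∀ m : M, metric m (timeDirection m) (timeDirection m) < 0
  /-- the linear connection: `connection X m v` is `∇_v X` at `m` -/
  connection : CovariantDerivative (𝓡 4) (EuclideanSpace ℝ (Fin 4))
    (fun m : M => TangentSpace (𝓡 4) m)
  connection_smooth : CovariantDerivative.ContMDiffCovariantDerivative connection ∞
  connection_metric : ∀ (m : M) (v : TangentSpace (𝓡 4) m)
    (X Y : ∀ p : M, TangentSpace (𝓡 4) p),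
    MDifferentiableAt (𝓡 4) (𝓡 4).tangent
      (fun p => (⟨p, X p⟩ : TangentBundle (𝓡 4) M)) m →
    MDifferentiableAt (𝓡 4) (𝓡 4).tangent
      (fun p => (⟨p, Y p⟩ : TangentBundle (𝓡 4) M)) m →
    mfderiv (𝓡 4) 𝓘(ℝ, ℝ) (fun p : M => metric p (X p) (Y p)) m v =
      metric m (connection X m v) (Y m) + metric m (X m) (connection Y m v)

variable {M : Type*} [TopologicalSpace M]
  [ChartedSpace (EuclideanSpace ℝ (Fin 4)) M] [IsManifold (𝓡 4) ∞ M]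

/-- A vector is future oriented if it is timelike and in the same half of the light cone as the
time direction. -/
def Spacetime.IsFutureOriented (U : Spacetime M) (m : M) (v : TangentSpace (𝓡 4) m) : Prop :=
  U.metric m v v < 0 ∧ U.metric m v (U.timeDirection m) < 0

/-- A connected spacelike hypersurface `S(0)`: a connected three dimensional manifold `S` embedded
in the universe, on which the metric induces a Riemannian (positive definite) metric. -/
structure SpacelikeHypersurface (U : Spacetime M) (S : Type*) [TopologicalSpace S]
    [ChartedSpace (EuclideanSpace ℝ (Fin 3)) S] [IsManifold (𝓡 3) ∞ S] where
  /-- the inclusion of the hypersurface -/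
  incl : S → M
  embedding : Manifold.IsSmoothEmbedding (𝓡 3) (𝓡 4) ∞ incl
  connected : ConnectedSpace S
  spacelike : ∀ (x : S) (v : TangentSpace (𝓡 3) x), v ≠ 0 →
    0 < U.metric (incl x) (mfderiv (𝓡 3) (𝓡 4) incl x v) (mfderiv (𝓡 3) (𝓡 4) incl x v)

/-- The Gaussian chart `m = Φ(x, t)` of the region swept by the geodesics that start from an open
domain of the hypersurface `S(0)` along its future oriented unit normal `n`. -/
structure GaussianChart {U : Spacetime M} {S : Type*} [TopologicalSpace S]
    [ChartedSpace (EuclideanSpace ℝ (Fin 3)) S] [IsManifold (𝓡 3) ∞ S]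
    (S₀ : SpacelikeHypersurface U S) where
  /-- the open domain of `S(0)` that defines the system -/
  domain : TopologicalSpace.Opens S
  /-- the map `Φ`, a diffeomorphism from `domain × ℝ` onto the region `Ω` occupied by the system -/
  chart : OpenPartialHomeomorph (S × ℝ) M
  source_eq : chart.source = (domain : Set S) ×ˢ Set.univ
  smooth : ContMDiffOn ((𝓡 3).prod 𝓘(ℝ, ℝ)) (𝓡 4) ∞ chart chart.source
  smooth_symm : ContMDiffOn (𝓡 4) ((𝓡 3).prod 𝓘(ℝ, ℝ)) ∞ chart.symm chart.target
  /-- the vector field `n` (only its values on the region `Ω` matter) -/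
  normal : ∀ m : M, TangentSpace (𝓡 4) m
  normal_smooth : ContMDiffOn (𝓡 4) (𝓡 4).tangent ∞
    (fun m => (⟨m, normal m⟩ : TangentBundle (𝓡 4) M)) chart.target
  /-- on `S(0)` the field `n` is normal to `S(0)`, of norm `-1` and future oriented -/
  normal_orthogonal : ∀ x ∈ domain, ∀ v : TangentSpace (𝓡 3) x,
    U.metric (S₀.incl x) (normal (S₀.incl x)) (mfderiv (𝓡 3) (𝓡 4) S₀.incl x v) = 0
  normal_unit : ∀ x ∈ domain,
    U.metric (S₀.incl x) (normal (S₀.incl x)) (normal (S₀.incl x)) = -1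
  normal_future : ∀ x ∈ domain, U.IsFutureOriented (S₀.incl x) (normal (S₀.incl x))
  /-- the integral curves of `n` are geodesics -/
  geodesic : ∀ m ∈ chart.target, U.connection normal m (normal m) = 0
  /-- `Φ` is the flow of `n` from `S(0)` -/
  chart_zero : ∀ x ∈ domain, chart (x, 0) = S₀.incl x
  chart_flow : ∀ x ∈ domain, IsMIntegralCurve (fun t : ℝ => chart (x, t)) normal

variable {U : Spacetime M} {S : Type*} [TopologicalSpace S]
  [ChartedSpace (EuclideanSpace ℝ (Fin 3)) S] [IsManifold (𝓡 3) ∞ S]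
  {S₀ : SpacelikeHypersurface U S}

/-- The region `Ω` of the universe occupied by the system. -/
def GaussianChart.region (G : GaussianChart S₀) : Set M := G.chart.target

/-- The chart used by the observer whose time coordinate is translated by `θ`: the event that this
observer labels `(x, t)` is `Φ(x, t - θ)`. -/
def GaussianChart.event (G : GaussianChart S₀) (θ : ℝ) (x : G.domain) (t : ℝ) : G.region :=
  ⟨G.chart ((x : S), t - θ), G.chart.map_source (by rw [G.source_eq]; exact ⟨x.2, trivial⟩)⟩

/-- The spatial label `x` of an event `m = Φ(x, t)`. -/
def GaussianChart.place (G : GaussianChart S₀) (m : G.region) : G.domain :=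
  ⟨(G.chart.symm (m : M)).1, by
    have h := G.chart.map_target m.2
    rw [G.source_eq] at h
    exact h.1⟩

/-- The time label `t` of an event `m = Φ(x, t)` for the reference observer. -/
def GaussianChart.time (G : GaussianChart S₀) (m : G.region) : ℝ :=
  (G.chart.symm (m : M)).2

theorem GaussianChart.event_place_time (G : GaussianChart S₀) (m : G.region) :
    G.event 0 (G.place m) (G.time m) = m := by
  apply Subtype.ext
  simp only [event, place, time, sub_zero]
  exact G.chart.right_inv m.2

theorem GaussianChart.place_event (G : GaussianChart S₀) (θ : ℝ) (x : G.domain) (t : ℝ) :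
    G.place (G.event θ x t) = x := by
  apply Subtype.ext
  simp only [event, place]
  rw [G.chart.left_inv (by rw [G.source_eq]; exact ⟨x.2, trivial⟩)]

theorem GaussianChart.time_event (G : GaussianChart S₀) (θ : ℝ) (x : G.domain) (t : ℝ) :
    G.time (G.event θ x t) = t - θ := by
  simp only [event, time]
  rw [G.chart.left_inv (by rw [G.source_eq]; exact ⟨x.2, trivial⟩)]

end Geometry

/-! ## Variables, observers and states -/

section Model

variable {M : Type*} [TopologicalSpace M]
  [ChartedSpace (EuclideanSpace ℝ (Fin 4)) M] [IsManifold (𝓡 4) ∞ M]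
  {U : Spacetime M} {S : Type*} [TopologicalSpace S]
  [ChartedSpace (EuclideanSpace ℝ (Fin 3)) S] [IsManifold (𝓡 3) ∞ S]
  {S₀ : SpacelikeHypersurface U S}
  {V : Type*} [NormedAddCommGroup V] [NormedSpace ℂ V]
  {F : M → Type*} [TopologicalSpace (TotalSpace V F)]
  [∀ m, AddCommGroup (F m)] [∀ m, Module ℂ (F m)]
  [∀ m, TopologicalSpace (F m)]

/-- The components, in the trivialization `e`, that the observer translated by `θ` reads at the
point that he labels `(x, t)` for a section `X` over the region of the system. -/
def reading (G : GaussianChart S₀) (e : Trivialization V (π V F)) [e.IsLinear ℂ]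
    (he : G.region ⊆ e.baseSet) (θ : ℝ) (X : ∀ m : G.region, F m) (x : G.domain) (t : ℝ) : V :=
  e.linearEquivAt ℂ (G.event θ x t : M) (he (G.event θ x t).2) (X (G.event θ x t))

/-- The gauge transformation `U(θ)` induced on sections by a translation of time by `θ`: the
components of `U(θ) X` are `(x, t) ↦ X(x, t - θ)`. -/
def translate (G : GaussianChart S₀) (e : Trivialization V (π V F)) [e.IsLinear ℂ]
    (he : G.region ⊆ e.baseSet) (θ : ℝ) :
    (∀ m : G.region, F m) →ₗ[ℂ] (∀ m : G.region, F m) :=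
  LinearMap.pi fun m =>
    (e.linearEquivAt ℂ (m : M) (he m.2)).symm.toLinearMap ∘ₗ
      (e.linearEquivAt ℂ (G.event θ (G.place m) (G.time m) : M)
        (he (G.event θ (G.place m) (G.time m)).2)).toLinearMap ∘ₗ
      LinearMap.proj (G.event θ (G.place m) (G.time m))

/-- `U(θ) X` is the section that has, for the reference observer, the components of `X` read by the
observer translated by `θ`. -/
theorem reading_translate (G : GaussianChart S₀) (e : Trivialization V (π V F)) [e.IsLinear ℂ]
    (he : G.region ⊆ e.baseSet) (θ : ℝ) (X : ∀ m : G.region, F m) (x : G.domain) (t : ℝ) :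
    reading G e he 0 (translate G e he θ X) x t = reading G e he θ X x t := by
  have h1 : G.place (G.event 0 x t) = x := G.place_event 0 x t
  have h2 : G.time (G.event 0 x t) = t := by rw [G.time_event, sub_zero]
  have h3 : reading G e he 0 (translate G e he θ X) x t =
      reading G e he θ X (G.place (G.event 0 x t)) (G.time (G.event 0 x t)) := by
    simp only [reading, translate, LinearMap.pi_apply, LinearMap.comp_apply, LinearMap.proj_apply,
      LinearEquiv.coe_coe, LinearEquiv.apply_symm_apply]
  rw [h3, h1, h2]

/-- A model of the system whose variables are sections, over the region `Ω`, of a complex vector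
bundle trivialized over `Ω`, together with its Hilbert space `H` and with the measures done by all
the observers that differ from the reference observer by a translation of time. -/
structure Model (G : GaussianChart S₀) (e : Trivialization V (π V F)) [e.IsLinear ℂ]
    (he : G.region ⊆ e.baseSet) (H : Type*) [NormedAddCommGroup H] [InnerProductSpace ℂ H] where
  /-- the vector space of the sections that the variables can be -/
  sectionSpace : Submodule ℂ (∀ m : G.region, F m)
  /-- all the observers use the same space of variables -/
  translate_mem : ∀ (θ : ℝ), ∀ X ∈ sectionSpace, translate G e he θ X ∈ sectionSpace
  /-- the linear chart, which represents each value of the variables by a vector of `H`. Its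
  positive definite kernel `K(X, Y) = ⟪Υ X, Υ Y⟫` is the inner product of the space of variables,
  for which `Υ` is an isometry, and `H` is the completion of that space. -/
  linearChart : sectionSpace →ₗ[ℂ] H
  linearChart_injective : Function.Injective linearChart
  linearChart_dense : DenseRange linearChart
  /-- the set of the states of the system -/
  states : Set H
  /-- the value of the variables measured by the observer translated by `θ`, expressed in the chart
  of the reference observer, when the system is in a given state -/
  measure : ℝ → states → sectionSpace
  /-- every observer uses a chart of the same model, that is with the same positive kernel -/
  measure_kernel : ∀ (θ : ℝ) (ψ₁ ψ₂ : states),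
    ⟪linearChart (measure θ ψ₁), linearChart (measure θ ψ₂)⟫_ℂ = ⟪(ψ₁ : H), (ψ₂ : H)⟫_ℂ
  /-- the measures of two observers are related by the gauge transformation -/
  measure_gauge : ∀ (θ : ℝ) (ψ : states),
    (measure θ ψ : ∀ m : G.region, F m) = translate G e he θ (measure 0 ψ)
  /-- the values of the variables that can be measured generate the space of variables -/
  measure_span : Submodule.span ℂ (Set.range (measure 0)) = ⊤
  /-- the translations are continuous for the norm of the space of variables -/
  translate_continuous : ∀ X : sectionSpace,
    Tendsto (fun θ : ℝ => linearChart ⟨translate G e he θ X, translate_mem θ X X.2⟩) (𝓝 0)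
      (𝓝 (linearChart X))

variable {G : GaussianChart S₀} {e : Trivialization V (π V F)} [e.IsLinear ℂ]
  {he : G.region ⊆ e.baseSet} {H : Type*} [NormedAddCommGroup H] [InnerProductSpace ℂ H]

/-- The evolution `ψ : ℝ → H` of the system whose variables have the value `X`: `ψ(t)` is the vector
that represents the value `U(t) X` of the variables for the observer translated by `t`. -/
def Model.evolution (P : Model G e he H) (X : P.sectionSpace) (t : ℝ) : H :=
  P.linearChart ⟨translate G e he t X, P.translate_mem t X X.2⟩

end Model

end TimeTranslation

end

/-!
The states span `E`, and all observers assign to two states the same inner product; hence each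
`U(θ)` preserves the kernel and extends from the dense range of `Υ` to a unitary operator of `H`,
still written `U(θ)`, and these operators form a strongly continuous group.

With `A` equal to `i` times the derivative of the group at `0`, unitarity makes `A` symmetric, and
off the real axis the Laplace transform of the group inverts `A - z`. A symmetric operator with
`A - z` and `A - conj z` surjective is self-adjoint.

The bounded truncations `Aₖ` commute with the group and converge to `A` on its domain. Along
`s ↦ exp (-i (t - s) Aₖ) U(s) ψ`, which joins `exp (-i t Aₖ) ψ` to `U(t) ψ`, the speed is
`‖Aₖ ψ - A ψ‖`; so `exp (-i t Aₖ) → U(t)` on the domain, hence everywhere by density. The constant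
`ħ` only rescales time.
-/

namespace TimeTranslation

open MeasureTheory

section Density

theorem tendsto_of_dense_of_lipschitzWith {ι α β : Type*} [PseudoEMetricSpace α]
    [PseudoEMetricSpace β] {l : Filter ι} {F : ι → α → β} {f : α → β} {K : NNReal} {D : Set α}
    (hF : ∀ i, LipschitzWith K (F i)) (hf : Continuous f) (hD : Dense D)
    (h : ∀ x ∈ D, Tendsto (F · x) l (𝓝 (f x))) (x : α) : Tendsto (F · x) l (𝓝 (f x)) :=
  ((LipschitzWith.uniformEquicontinuous F K hF).equicontinuous x).tendsto_of_mem_closure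
    hf.continuousWithinAt h (hD x)

theorem inner_map_map_of_span_eq_top {𝕜 E H : Type*} [RCLike 𝕜] [AddCommGroup E] [Module 𝕜 E]
    [NormedAddCommGroup H] [InnerProductSpace 𝕜 H] {f g : E →ₗ[𝕜] H} {s : Set E}
    (hs : Submodule.span 𝕜 s = ⊤) (h : ∀ x ∈ s, ∀ y ∈ s, ⟪f x, f y⟫_𝕜 = ⟪g x, g y⟫_𝕜) (x y : E) :
    ⟪f x, f y⟫_𝕜 = ⟪g x, g y⟫_𝕜 := by
  have hright : ∀ x ∈ s, innerₛₗ 𝕜 (f x) ∘ₗ f = innerₛₗ 𝕜 (g x) ∘ₗ g := fun x hx =>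
    LinearMap.ext_on hs (h x hx)
  have hleft : innerₛₗ 𝕜 (f y) ∘ₗ f = innerₛₗ 𝕜 (g y) ∘ₗ g := LinearMap.ext_on hs fun x hx => by
    simpa using congrArg (starRingEnd 𝕜) (LinearMap.congr_fun (hright x hx) y)
  simpa using congrArg (starRingEnd 𝕜) (LinearMap.congr_fun hleft x)

end Density

section Symmetric

variable {𝕜 H : Type*} [RCLike 𝕜] [NormedAddCommGroup H] [InnerProductSpace 𝕜 H]
  {A : H →ₗ.[𝕜] H}

theorem inner_apply_sub_smul (hA : A.IsFormalAdjoint A) (z : 𝕜) (ψ φ : A.domain) :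
    ⟪A ψ - z • (ψ : H), φ⟫_𝕜 = ⟪(ψ : H), A φ - starRingEnd 𝕜 z • (φ : H)⟫_𝕜 := by
  rw [inner_sub_left, inner_sub_right, inner_smul_left, inner_smul_right, hA ψ φ]

theorem dense_domain_of_surjective_sub_smul [CompleteSpace H] (hA : A.IsFormalAdjoint A) {z : 𝕜}
    (hz : Function.Surjective fun ψ : A.domain => A ψ - z • (ψ : H))
    (hz' : Function.Surjective fun ψ : A.domain => A ψ - starRingEnd 𝕜 z • (ψ : H)) :
    Dense (A.domain : Set H) := by
  rw [Submodule.dense_iff_topologicalClosure_eq_top, Submodule.topologicalClosure_eq_top_iff,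
    Submodule.eq_bot_iff]
  intro y hy
  obtain ⟨w, rfl⟩ := hz y
  suffices (w : H) = 0 by simp_all
  refine ext_inner_right 𝕜 fun x => ?_
  obtain ⟨v, rfl⟩ := hz' x
  rw [← inner_apply_sub_smul hA, inner_zero_left]
  exact (Submodule.mem_orthogonal' _ _).1 hy v v.2

theorem isSelfAdjoint_of_surjective_sub_smul [CompleteSpace H] (hA : A.IsFormalAdjoint A) {z : 𝕜}
    (hz : Function.Surjective fun ψ : A.domain => A ψ - z • (ψ : H))
    (hz' : Function.Surjective fun ψ : A.domain => A ψ - starRingEnd 𝕜 z • (ψ : H)) :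
    IsSelfAdjoint A := by
  have hdense := dense_domain_of_surjective_sub_smul hA hz hz'
  have hle := hA.le_adjoint hdense
  refine (LinearPMap.eq_of_le_of_domain_eq hle (le_antisymm hle.1 fun y hy => ?_)).symm
  obtain ⟨w, hw⟩ := hz (A.adjoint ⟨y, hy⟩ - z • y)
  suffices y = w from this ▸ w.2
  refine ext_inner_right 𝕜 fun x => ?_
  obtain ⟨v, rfl⟩ := hz' x
  have hadj : ⟪A.adjoint ⟨y, hy⟩, v⟫_𝕜 = ⟪y, A v⟫_𝕜 :=
    LinearPMap.adjoint_isFormalAdjoint hdense ⟨y, hy⟩ v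
  calc ⟪y, A v - starRingEnd 𝕜 z • (v : H)⟫_𝕜
      = ⟪A.adjoint ⟨y, hy⟩ - z • y, v⟫_𝕜 := by
        rw [inner_sub_left, inner_sub_right, inner_smul_left, inner_smul_right, hadj]
    _ = ⟪(w : H), A v - starRingEnd 𝕜 z • (v : H)⟫_𝕜 := by
        rw [← hw, inner_apply_sub_smul hA]

end Symmetric

section Resolvent

variable {H : Type*} [NormedAddCommGroup H] [InnerProductSpace ℂ H] {A : H →ₗ.[ℂ] H} {z : ℂ}
  {R R' : H →L[ℂ] H}

theorem abs_im_mul_norm_le_norm_sub_smul (hA : A.IsFormalAdjoint A) (z : ℂ) (ψ : A.domain) :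
    |z.im| * ‖(ψ : H)‖ ≤ ‖A ψ - z • (ψ : H)‖ := by
  have hreal : (⟪(ψ : H), A ψ⟫_ℂ).im = 0 := by
    rw [← Complex.conj_eq_iff_im, inner_conj_symm, hA]
  have him : (⟪(ψ : H), A ψ - z • (ψ : H)⟫_ℂ).im = -(z.im * ‖(ψ : H)‖ ^ 2) := by
    rw [inner_sub_right, inner_smul_right, inner_self_eq_norm_sq_to_K, Complex.sub_im, hreal,
      zero_sub, RCLike.ofReal_eq_complex_ofReal, ← Complex.ofReal_pow, Complex.im_mul_ofReal]
  rcases (norm_nonneg (ψ : H)).eq_or_lt with h0 | hpos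
  · simp [← h0]
  refine le_of_mul_le_mul_right ?_ hpos
  calc |z.im| * ‖(ψ : H)‖ * ‖(ψ : H)‖ = |(⟪(ψ : H), A ψ - z • (ψ : H)⟫_ℂ).im| := by
        rw [him, abs_neg, abs_mul, abs_sq, sq, mul_assoc]
    _ ≤ ‖⟪(ψ : H), A ψ - z • (ψ : H)⟫_ℂ‖ := Complex.abs_im_le_norm _
    _ ≤ ‖A ψ - z • (ψ : H)‖ * ‖(ψ : H)‖ := by
        rw [mul_comm]; exact norm_inner_le_norm _ _

theorem exists_isResolvent (hA : A.IsFormalAdjoint A) (him : z.im ≠ 0)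
    (hz : Function.Surjective fun ψ : A.domain => A ψ - z • (ψ : H)) :
    ∃ R : H →L[ℂ] H, IsResolvent A z R := by
  let B : A.domain →ₗ[ℂ] H := A.toFun - z • A.domain.subtype
  have hB : ∀ ψ : A.domain, |z.im| * ‖(ψ : H)‖ ≤ ‖B ψ‖ := abs_im_mul_norm_le_norm_sub_smul hA z
  have hinj : Function.Injective B := (injective_iff_map_eq_zero B).2 fun ψ hψ => by
    have := hB ψ
    rw [hψ, norm_zero] at this
    simpa using nonpos_of_mul_nonpos_right this (abs_pos.2 him)
  let e : A.domain ≃ₗ[ℂ] H := .ofBijective B ⟨hinj, hz⟩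
  refine ⟨(A.domain.subtype ∘ₗ e.symm.toLinearMap).mkContinuous |z.im|⁻¹ fun x => ?_,
    fun x => ⟨(e.symm x).2, e.apply_symm_apply x⟩,
    fun y => congrArg Subtype.val (e.symm_apply_apply y)⟩
  rw [inv_mul_eq_div, le_div_iff₀' (abs_pos.2 him)]
  simpa using! (hB (e.symm x)).trans_eq (congrArg norm (e.apply_symm_apply x))

namespace IsResolvent

theorem mem_graph (hR : IsResolvent A z R) (x : H) : (R x, x + z • R x) ∈ A.graph := by
  obtain ⟨hx, hAx⟩ := hR.1 x
  exact LinearPMap.mem_graph_iff A |>.2 ⟨⟨R x, hx⟩, rfl, sub_eq_iff_eq_add.1 hAx⟩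

theorem apply_sub_smul (hR : IsResolvent A z R) {ψ φ : H} (h : (ψ, φ) ∈ A.graph) :
    R (φ - z • ψ) = ψ := by
  obtain ⟨ψ, rfl, rfl⟩ := LinearPMap.mem_graph_iff A |>.1 h
  exact hR.2 ψ

theorem norm_le (hR : IsResolvent A z R) (hA : A.IsFormalAdjoint A) (x : H) :
    |z.im| * ‖R x‖ ≤ ‖x‖ := by
  obtain ⟨hx, hAx⟩ := hR.1 x
  exact (abs_im_mul_norm_le_norm_sub_smul hA z ⟨R x, hx⟩).trans_eq (congrArg norm hAx)

theorem inner_left (hR : IsResolvent A z R) (hR' : IsResolvent A (starRingEnd ℂ z) R')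
    (hA : A.IsFormalAdjoint A) (x y : H) : ⟪R x, y⟫_ℂ = ⟪x, R' y⟫_ℂ := by
  obtain ⟨hx, hAx⟩ := hR.1 x
  obtain ⟨hy, hAy⟩ := hR'.1 y
  simpa only [hAx, hAy] using (inner_apply_sub_smul hA z ⟨R x, hx⟩ ⟨R' y, hy⟩).symm

theorem map_comm (hR : IsResolvent A z R) {T : H →L[ℂ] H}
    (hT : ∀ ψ φ, (ψ, φ) ∈ A.graph → (T ψ, T φ) ∈ A.graph) (x : H) : R (T x) = T (R x) := by
  simpa using hR.apply_sub_smul (hT _ _ (hR.mem_graph x))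

end IsResolvent

end Resolvent

section Truncation

variable {H : Type*} [NormedAddCommGroup H] [InnerProductSpace ℂ H] {A : H →ₗ.[ℂ] H}

theorem tendsto_neg_smul_resolvent {ι : Type*} {l : Filter ι} {z : ι → ℂ} {R : ι → H →L[ℂ] H}
    (hA : A.IsFormalAdjoint A) (hdense : Dense (A.domain : Set H))
    (hR : ∀ i, IsResolvent A (z i) (R i)) (hre : ∀ i, (z i).re = 0)
    (him : Tendsto (fun i => |(z i).im|) l atTop) (x : H) :
    Tendsto (fun i => -z i • R i x) l (𝓝 x) := by
  have hcontract : ∀ i y, ‖-z i • R i y‖ ≤ ‖y‖ := fun i y => by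
    rw [norm_smul, norm_neg, ← Complex.abs_im_eq_norm.2 (hre i)]
    exact (hR i).norm_le hA y
  refine tendsto_of_dense_of_lipschitzWith (F := fun i => ⇑(-z i • R i)) (f := id)
    (fun i => AddMonoidHomClass.lipschitz_of_bound (-z i • R i) 1 fun y => by
      simpa only [one_mul] using! hcontract i y) continuous_id hdense (fun ψ hψ => ?_) x
  have happly : ∀ i, -z i • R i ψ = ψ - R i (A ⟨ψ, hψ⟩) := fun i => by
    have h := (hR i).2 ⟨ψ, hψ⟩
    rw [map_sub, map_smul] at h
    rw [eq_sub_iff_add_eq', neg_smul, ← sub_eq_add_neg, h]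
  have hzero : Tendsto (fun i => R i (A ⟨ψ, hψ⟩)) l (𝓝 0) := by
    refine squeeze_zero_norm' ?_ (him.const_div_atTop ‖A ⟨ψ, hψ⟩‖)
    filter_upwards [him.eventually_gt_atTop 0] with i hi
    exact (le_div_iff₀' hi).2 ((hR i).norm_le hA _)
  simpa only [smul_apply, happly, id, sub_zero] using hzero.const_sub ψ

theorem truncation_apply_of_mem_graph {k : ℂ} {R R' : H →L[ℂ] H}
    (hR : IsResolvent A (Complex.I * k) R) (hR' : IsResolvent A (-(Complex.I * k)) R')
    {ψ φ : H} (h : (ψ, φ) ∈ A.graph) :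
    truncation k R R' ψ =
      (1 / 2 : ℂ) • (-(Complex.I * k) • R φ + -(-(Complex.I * k)) • R' φ) := by
  have hψ := hR.apply_sub_smul h
  have hψ' := hR'.apply_sub_smul h
  rw [map_sub, map_smul, sub_eq_iff_eq_add] at hψ hψ'
  rw [hψ, hψ']
  simp only [truncation, smul_apply, add_apply]
  match_scalars
  · linear_combination (k ^ 2 / 2) * Complex.I_sq
  · linear_combination (k ^ 2 / 2) * Complex.I_sq
  · ring

theorem tendsto_truncation_of_mem_graph {ι : Type*} {l : Filter ι} {k : ι → ℝ}
    {R R' : ι → H →L[ℂ] H} (hA : A.IsFormalAdjoint A) (hdense : Dense (A.domain : Set H))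
    (hR : ∀ i, IsResolvent A (Complex.I * k i) (R i))
    (hR' : ∀ i, IsResolvent A (-(Complex.I * k i)) (R' i))
    (hk : Tendsto (fun i => |k i|) l atTop) {ψ φ : H} (h : (ψ, φ) ∈ A.graph) :
    Tendsto (fun i => truncation (k i) (R i) (R' i) ψ) l (𝓝 φ) := by
  have hlim := tendsto_neg_smul_resolvent hA hdense hR (by simp) (by simpa using hk) φ
  have hlim' := tendsto_neg_smul_resolvent hA hdense hR' (by simp) (by simpa using hk) φ
  have hmean : (1 / 2 : ℂ) • (φ + φ) = φ := by module
  simpa only [truncation_apply_of_mem_graph (hR _) (hR' _) h, hmean] using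
    (hlim.add hlim').const_smul (1 / 2 : ℂ)

theorem truncation_map_comm {k z z' : ℂ} {R R' T : H →L[ℂ] H} (hR : IsResolvent A z R)
    (hR' : IsResolvent A z' R') (hT : ∀ ψ φ, (ψ, φ) ∈ A.graph → (T ψ, T φ) ∈ A.graph) (x : H) :
    truncation k R R' (T x) = T (truncation k R R' x) := by
  simp only [truncation, smul_apply, add_apply, map_smul, map_add, hR.map_comm hT,
    hR'.map_comm hT]

theorem isSelfAdjoint_truncation [CompleteSpace H] {k : ℝ} {R R' : H →L[ℂ] H}
    (hA : A.IsFormalAdjoint A) (hR : IsResolvent A (Complex.I * k) R)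
    (hR' : IsResolvent A (-(Complex.I * k)) R') : IsSelfAdjoint (truncation k R R') := by
  have hadj : star R = R' := by
    rw [ContinuousLinearMap.star_eq_adjoint, eq_comm, ContinuousLinearMap.eq_adjoint_iff]
    intro x y
    have := hR.inner_left (R' := R') (by simpa using hR') hA y x
    rw [← inner_conj_symm, ← this, inner_conj_symm]
  rw [IsSelfAdjoint, truncation, star_smul, star_add, ← hadj, star_star, add_comm]
  simp

end Truncation

section Integral

variable {E : Type*} [NormedAddCommGroup E] [NormedSpace ℝ E]

theorem hasDerivAt_integral_Ioi [CompleteSpace E] {f : ℝ → E} (hf : Continuous f)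
    (hint : ∀ a, IntegrableOn f (Set.Ioi a)) (b : ℝ) :
    HasDerivAt (fun a => ∫ t in Set.Ioi a, f t) (-f b) b := by
  have hsplit : ∀ a, ∫ t in Set.Ioi a, f t = (∫ t in Set.Ioi b, f t) - ∫ t in b..a, f t := fun a =>
    eq_sub_of_add_eq' (intervalIntegral.integral_interval_add_Ioi (hint b) (hint a))
  refine HasDerivAt.congr_of_eventuallyEq ?_ (.of_forall hsplit)
  exact (intervalIntegral.integral_hasDerivAt_right (hf.intervalIntegrable _ _)
    (hf.stronglyMeasurableAtFilter _ _) hf.continuousAt).const_sub _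

end Integral

/-- A strongly continuous one-parameter group of unitary operators of `H`. -/
structure OneParameterUnitaryGroup (H : Type*) [NormedAddCommGroup H]
    [InnerProductSpace ℂ H] where
  op : ℝ → H ≃ₗᵢ[ℂ] H
  op_add : ∀ (s t : ℝ) (ψ : H), op (s + t) ψ = op s (op t ψ)
  continuous_op : ∀ ψ : H, Continuous fun t : ℝ => op t ψ

namespace OneParameterUnitaryGroup

variable {H : Type*} [NormedAddCommGroup H] [InnerProductSpace ℂ H]

theorem op_zero (U : OneParameterUnitaryGroup H) (ψ : H) : U.op 0 ψ = ψ :=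
  (U.op 0).injective (by rw [← U.op_add, add_zero])

/-- The group `t ↦ U (c t)`; for `c = -1` it is the time reversal of `U`. -/
def rescale (U : OneParameterUnitaryGroup H) (c : ℝ) : OneParameterUnitaryGroup H where
  op t := U.op (c * t)
  op_add s t ψ := by rw [mul_add, U.op_add]
  continuous_op ψ := (U.continuous_op ψ).comp (continuous_const_mul c)

/-- The infinitesimal generator of the group, with the factor `i` that makes it self-adjoint:
`U t = exp (-i t A)`. Its domain consists of the vectors along which the group is differentiable. -/
noncomputable def generator (U : OneParameterUnitaryGroup H) : H →ₗ.[ℂ] H where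
  domain :=
    { carrier := {ψ | DifferentiableAt ℝ (fun t => U.op t ψ) 0}
      zero_mem' := by simp
      add_mem' := fun hψ hφ => by simpa using! hψ.add hφ
      smul_mem' := fun c ψ hψ => by simpa using! hψ.const_smul c }
  toFun :=
    { toFun := fun ψ => Complex.I • deriv (fun t => U.op t (ψ : H)) 0
      map_add' := fun ψ φ => by
        simp only [Submodule.coe_add, map_add, deriv_fun_add ψ.2 φ.2, smul_add]
      map_smul' := fun c ψ => by
        simp only [Submodule.coe_smul, map_smul, deriv_fun_const_smul c ψ.2, smul_comm c,
          RingHom.id_apply] }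

variable {U : OneParameterUnitaryGroup H} {ψ φ : H}

theorem mem_generator_graph_iff :
    (ψ, φ) ∈ U.generator.graph ↔ HasDerivAt (fun t => U.op t ψ) (-(Complex.I • φ)) 0 := by
  rw [LinearPMap.mem_graph_iff]
  constructor
  · rintro ⟨⟨ψ, hψ⟩, rfl, rfl⟩
    convert hψ.hasDerivAt using 1
    simp [generator, smul_smul]
  · intro h
    exact ⟨⟨ψ, h.differentiableAt⟩, rfl, by simp [generator, h.deriv, smul_smul]⟩

theorem hasDerivAt_op_of_mem_graph (h : (ψ, φ) ∈ U.generator.graph) (t : ℝ) :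
    HasDerivAt (fun s => U.op s ψ) (-(Complex.I • U.op t φ)) t := by
  have hshift : HasDerivAt (fun s => U.op (s - t) ψ) (-(Complex.I • φ)) t :=
    HasDerivAt.comp_sub_const t t (by simpa using mem_generator_graph_iff.1 h)
  have hop := ((U.op t).toContinuousLinearEquiv.toContinuousLinearMap.restrictScalars
    ℝ).hasFDerivAt.comp_hasDerivAt t hshift
  refine (hop.congr_deriv ?_).congr_of_eventuallyEq (.of_forall fun s => ?_)
  · exact (map_neg _ _).trans (congrArg Neg.neg (map_smul (U.op t) _ _))
  · exact (congrArg (U.op · ψ) (add_sub_cancel t s)).symm.trans (U.op_add _ _ _)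

theorem op_mem_generator_graph (h : (ψ, φ) ∈ U.generator.graph) (t : ℝ) :
    (U.op t ψ, U.op t φ) ∈ U.generator.graph := by
  have hderiv := HasDerivAt.comp_add_const 0 t
    (by simpa only [zero_add] using hasDerivAt_op_of_mem_graph h t)
  simpa only [mem_generator_graph_iff, U.op_add] using hderiv

theorem mem_generator_graph_of_rescale {c : ℝ} (hc : c ≠ 0)
    (h : (ψ, c • φ) ∈ (U.rescale c).generator.graph) : (ψ, φ) ∈ U.generator.graph := by
  rw [mem_generator_graph_iff] at h ⊢
  have hscale := h.scomp_of_eq (h := fun t : ℝ => c⁻¹ * t) 0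
    ((hasDerivAt_id (0 : ℝ)).const_mul c⁻¹) (by simp)
  refine (hscale.congr_deriv ?_).congr_of_eventuallyEq (.of_forall fun t => ?_)
  · rw [mul_one, smul_neg, smul_comm, inv_smul_smul₀ hc]
  · simp [rescale, mul_inv_cancel_left₀ hc]

theorem isFormalAdjoint_generator (U : OneParameterUnitaryGroup H) :
    U.generator.IsFormalAdjoint U.generator := by
  intro ψ φ
  have hinner := HasDerivAt.inner ℂ (mem_generator_graph_iff.1 (U.generator.mem_graph ψ))
    (mem_generator_graph_iff.1 (U.generator.mem_graph φ))
  simp only [LinearIsometryEquiv.inner_map_map, op_zero, inner_neg_left, inner_neg_right,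
    inner_smul_left, inner_smul_right, Complex.conj_I] at hinner
  have hzero := hinner.unique (hasDerivAt_const (0 : ℝ) ⟪(ψ : H), (φ : H)⟫_ℂ)
  linear_combination (-Complex.I) * hzero +
    (⟪U.generator ψ, (φ : H)⟫_ℂ - ⟪(ψ : H), U.generator φ⟫_ℂ) * Complex.I_sq

section LaplaceTransform

variable {z : ℂ}

theorem integrableOn_exp_smul_op (U : OneParameterUnitaryGroup H) (hz : 0 < z.im) (x : H) (a : ℝ) :
    IntegrableOn (fun t : ℝ => Complex.exp (Complex.I * z * t) • U.op t x) (Set.Ioi a) := by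
  have hexp := integrableOn_exp_mul_complex_Ioi (a := Complex.I * z) (by simpa using hz) a
  refine (hexp.norm.mul_const ‖x‖).mono'
    ((by fun_prop : Continuous fun t : ℝ => Complex.exp (Complex.I * z * t)).smul
      (U.continuous_op x)).aestronglyMeasurable (.of_forall fun t => ?_)
  rw [norm_smul, LinearIsometryEquiv.norm_map]

theorem op_integral_exp_smul_op [CompleteSpace H] (U : OneParameterUnitaryGroup H) (hz : 0 < z.im)
    (x : H) (s : ℝ) :
    U.op s (∫ t in Set.Ioi (0 : ℝ), Complex.exp (Complex.I * z * t) • U.op t x) =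
      Complex.exp (-(Complex.I * z * s)) •
        ∫ t in Set.Ioi s, Complex.exp (Complex.I * z * t) • U.op t x := by
  have hshift : ∀ t : ℝ, U.op s (Complex.exp (Complex.I * z * t) • U.op t x) =
      Complex.exp (-(Complex.I * z * s)) •
        (Complex.exp (Complex.I * z * (t + s : ℝ)) • U.op (t + s) x) := fun t => by
    rw [map_smul, ← U.op_add, add_comm s, smul_smul, ← Complex.exp_add]
    congr 2
    push_cast
    ring
  calc U.op s (∫ t in Set.Ioi (0 : ℝ), Complex.exp (Complex.I * z * t) • U.op t x)
      = ∫ t in Set.Ioi (0 : ℝ), U.op s (Complex.exp (Complex.I * z * t) • U.op t x) :=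
        ((U.op s).toContinuousLinearEquiv.toContinuousLinearMap.integral_comp_comm
          (U.integrableOn_exp_smul_op hz x 0)).symm
    _ = _ := by
        simp only [hshift]
        rw [integral_smul]
        congr 1
        simpa using (measurePreserving_add_right volume s).setIntegral_preimage_emb
          (measurableEmbedding_addRight s)
          (fun t : ℝ => Complex.exp (Complex.I * z * t) • U.op t x) (Set.Ioi s)

/-- The resolvent `(A - z)⁻¹ x` of the generator `A`, for `z` in the upper half-plane, as a Laplace
transform: formally `(A - z)⁻¹ = i ∫₀^∞ exp (i z t) exp (-i t A) dt`. -/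
noncomputable def laplaceResolvent (U : OneParameterUnitaryGroup H) (z : ℂ) (x : H) : H :=
  Complex.I • ∫ t in Set.Ioi (0 : ℝ), Complex.exp (Complex.I * z * t) • U.op t x

theorem laplaceResolvent_mem_graph [CompleteSpace H] (U : OneParameterUnitaryGroup H)
    (hz : 0 < z.im) (x : H) :
    (U.laplaceResolvent z x, x + z • U.laplaceResolvent z x) ∈ U.generator.graph := by
  have hint := hasDerivAt_integral_Ioi
    ((by fun_prop : Continuous fun t : ℝ => Complex.exp (Complex.I * z * t)).smul
      (U.continuous_op x)) (U.integrableOn_exp_smul_op hz x) 0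
  have hexp := ((hasDerivAt_id (0 : ℂ)).const_mul (Complex.I * z)).neg.cexp.comp_ofReal
  rw [mem_generator_graph_iff]
  simp only [laplaceResolvent, map_smul, U.op_integral_exp_smul_op hz x]
  refine ((hexp.smul hint).const_smul Complex.I).congr_deriv ?_
  simp [op_zero, smul_smul, mul_comm z, add_comm]

theorem generator_sub_smul_surjective [CompleteSpace H] (U : OneParameterUnitaryGroup H)
    (hz : z.im ≠ 0) :
    Function.Surjective fun ψ : U.generator.domain => U.generator ψ - z • (ψ : H) := by
  suffices ∀ x, ∃ ψ, (ψ, x + z • ψ) ∈ U.generator.graph by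
    intro x
    obtain ⟨ψ, h⟩ := this x
    obtain ⟨ψ, rfl, hψ⟩ := (LinearPMap.mem_graph_iff _).1 h
    exact ⟨ψ, sub_eq_of_eq_add hψ⟩
  intro x
  rcases hz.lt_or_gt with hneg | hpos
  · refine ⟨(U.rescale (-1)).laplaceResolvent (-z) (-x),
      mem_generator_graph_of_rescale (neg_ne_zero.2 one_ne_zero) ?_⟩
    simpa [add_comm] using
      (U.rescale (-1)).laplaceResolvent_mem_graph (z := -z) (by simpa using hneg) (-x)
  · exact ⟨_, U.laplaceResolvent_mem_graph hpos x⟩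

theorem isSelfAdjoint_generator [CompleteSpace H] (U : OneParameterUnitaryGroup H) :
    IsSelfAdjoint U.generator :=
  isSelfAdjoint_of_surjective_sub_smul U.isFormalAdjoint_generator (z := Complex.I)
    (U.generator_sub_smul_surjective (by simp)) (U.generator_sub_smul_surjective (by simp))

end LaplaceTransform

end OneParameterUnitaryGroup

section Exponential

variable {H : Type*} [NormedAddCommGroup H] [InnerProductSpace ℂ H] [CompleteSpace H]
  {C : H →L[ℂ] H}

theorem norm_exp_smul_of_mem_skewAdjoint (hC : C ∈ skewAdjoint (H →L[ℂ] H)) (t : ℝ) (x : H) :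
    ‖NormedSpace.exp (t • C) x‖ = ‖x‖ := by
  let : NormedAlgebra ℚ (H →L[ℂ] H) := .restrictScalars ℚ ℂ _
  have hmem := NormedSpace.exp_mem_unitary_of_mem_skewAdjoint (skewAdjoint.smul_mem t hC)
  exact ContinuousLinearMap.norm_map_of_mem_unitary hmem x

namespace OneParameterUnitaryGroup

variable {U : OneParameterUnitaryGroup H} {ψ φ : H}

theorem hasDerivAt_exp_sub_smul_op (hcomm : ∀ t x, C (U.op t x) = U.op t (C x))
    (h : (ψ, φ) ∈ U.generator.graph) (t s : ℝ) :
    HasDerivAt (fun s : ℝ => NormedSpace.exp ((t - s) • C) (U.op s ψ))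
      (-NormedSpace.exp ((t - s) • C) (U.op s (C ψ + Complex.I • φ))) s := by
  have hexp : HasDerivAt (fun s : ℝ => NormedSpace.exp ((t - s) • C))
      (-(NormedSpace.exp ((t - s) • C) * C)) s := by
    simpa using! (hasDerivAt_exp_smul_const (𝕂 := ℝ) C (t - s)).scomp s
      ((hasDerivAt_id s).const_sub t)
  have hprod := HasDerivAt.clm_apply
    ((ContinuousLinearMap.restrictScalarsL ℂ H H ℝ ℝ).hasFDerivAt.comp_hasDerivAt s hexp)
    (hasDerivAt_op_of_mem_graph h s)
  refine hprod.congr_deriv ?_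
  change -(NormedSpace.exp ((t - s) • C) (C (U.op s ψ))) +
    NormedSpace.exp ((t - s) • C) (-(Complex.I • U.op s φ)) = _
  rw [hcomm, map_neg, ← neg_add, ← map_add, map_add (U.op s), map_smul]

theorem norm_exp_smul_sub_op_le (hC : C ∈ skewAdjoint (H →L[ℂ] H))
    (hcomm : ∀ t x, C (U.op t x) = U.op t (C x)) (h : (ψ, φ) ∈ U.generator.graph) (t : ℝ) :
    ‖NormedSpace.exp (t • C) ψ - U.op t ψ‖ ≤ ‖C ψ + Complex.I • φ‖ * |t| := by
  have hmean := convex_univ.norm_image_sub_le_of_norm_hasDerivWithin_le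
    (fun s _ => (hasDerivAt_exp_sub_smul_op hcomm h t s).hasDerivWithinAt)
    (fun s _ => by
      rw [norm_neg, norm_exp_smul_of_mem_skewAdjoint hC, LinearIsometryEquiv.norm_map])
    (Set.mem_univ t) (Set.mem_univ 0)
  simpa [op_zero] using hmean

theorem tendsto_exp_smul_op {ι : Type*} {l : Filter ι} {C : ι → H →L[ℂ] H}
    (hC : ∀ i, C i ∈ skewAdjoint (H →L[ℂ] H)) (hcomm : ∀ i t x, C i (U.op t x) = U.op t (C i x))
    (hlim : ∀ ψ φ, (ψ, φ) ∈ U.generator.graph → Tendsto (C · ψ) l (𝓝 (-(Complex.I • φ))))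
    (t : ℝ) (x : H) : Tendsto (fun i => NormedSpace.exp (t • C i) x) l (𝓝 (U.op t x)) := by
  refine tendsto_of_dense_of_lipschitzWith (F := fun i => ⇑(NormedSpace.exp (t • C i)))
    (fun i => (AddMonoidHomClass.isometry_of_norm (NormedSpace.exp (t • C i))
      (norm_exp_smul_of_mem_skewAdjoint (hC i) t)).lipschitz)
    (U.op t).continuous U.isSelfAdjoint_generator.dense_domain (fun ψ hψ => ?_) x
  have hgraph := U.generator.mem_graph ⟨ψ, hψ⟩
  have hbound : Tendsto (fun i => ‖C i ψ + Complex.I • U.generator ⟨ψ, hψ⟩‖ * |t|) l (𝓝 0) := by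
    simpa using ((hlim _ _ hgraph).add_const (Complex.I • U.generator ⟨ψ, hψ⟩)).norm.mul_const |t|
  exact tendsto_iff_norm_sub_tendsto_zero.2 <| squeeze_zero (fun _ => norm_nonneg _)
    (fun i => norm_exp_smul_sub_op_le (hC i) (hcomm i) hgraph t) hbound

theorem exists_isResolvent_generator (U : OneParameterUnitaryGroup H) {z : ℂ} (hz : z.im ≠ 0) :
    ∃ R : H →L[ℂ] H, IsResolvent U.generator z R :=
  exists_isResolvent U.isFormalAdjoint_generator hz (U.generator_sub_smul_surjective hz)

theorem isExp_generator (U : OneParameterUnitaryGroup H) (t : ℝ) :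
    IsExp U.generator (-(Complex.I * t)) (U.op t : H →L[ℂ] H) := by
  have hA := U.isFormalAdjoint_generator
  have hne : ∀ n : ℕ, (n + 1 : ℝ) ≠ 0 := Nat.cast_add_one_ne_zero
  choose R hR using fun n : ℕ => U.exists_isResolvent_generator
    (z := Complex.I * (n + 1 : ℝ)) (by simpa only [Complex.I_mul_im, Complex.ofReal_re] using hne n)
  choose R' hR' using fun n : ℕ => U.exists_isResolvent_generator
    (z := -(Complex.I * (n + 1 : ℝ)))
    (by simpa only [Complex.neg_im, Complex.I_mul_im, Complex.ofReal_re, neg_ne_zero] using hne n)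
  have hk : Tendsto (fun n : ℕ => |(n + 1 : ℝ)|) atTop atTop :=
    tendsto_abs_atTop_atTop.comp (tendsto_atTop_add_const_right _ 1 tendsto_natCast_atTop_atTop)
  refine ⟨R, R', by simpa using hR, by simpa using hR', fun ψ => ?_⟩
  refine (tendsto_exp_smul_op (U := U)
    (C := fun n : ℕ => -(Complex.I • truncation (n + 1 : ℝ) (R n) (R' n)))
    (fun n => ?_) (fun n s x => ?_) (fun ψ φ h => ?_) t ψ).congr fun n => ?_
  · rw [skewAdjoint.mem_iff, star_neg, star_smul,
      (isSelfAdjoint_truncation hA (hR n) (hR' n)).star_eq, Complex.star_def, Complex.conj_I,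
      neg_smul]
  · simpa using truncation_map_comm (T := U.op s) (hR n) (hR' n)
      (fun _ _ h => op_mem_generator_graph h s) x
  · exact ((tendsto_truncation_of_mem_graph hA U.isSelfAdjoint_generator.dense_domain hR hR' hk
      h).const_smul Complex.I).neg
  · congr 2
    push_cast
    rw [← Complex.coe_smul]
    module

end OneParameterUnitaryGroup

end Exponential

namespace OneParameterUnitaryGroup

variable {H : Type*} [NormedAddCommGroup H] [InnerProductSpace ℂ H] {U : OneParameterUnitaryGroup H}
  {c : ℝ}

theorem rescale_op_div (U : OneParameterUnitaryGroup H) (hc : c ≠ 0) (t : ℝ) :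
    (U.rescale c).op (t / c) = U.op t :=
  congrArg U.op (mul_div_cancel₀ t hc)

theorem isExp_generator_rescale [CompleteSpace H] (U : OneParameterUnitaryGroup H) (hc : c ≠ 0)
    (t : ℝ) : IsExp (U.rescale c).generator (t / (Complex.I * c)) (U.op t : H →L[ℂ] H) := by
  have hexp := (U.rescale c).isExp_generator (t / c)
  rw [U.rescale_op_div hc] at hexp
  convert hexp using 1
  simp [div_eq_mul_inv]
  ring

theorem schrodinger_rescale (hc : c ≠ 0) {ψ : H} (hψ : ψ ∈ (U.rescale c).generator.domain)
    (t : ℝ) :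
    ∃ (h : U.op t ψ ∈ (U.rescale c).generator.domain) (ψ' : H),
      HasDerivAt (fun s : ℝ => U.op s ψ) ψ' t ∧
        (Complex.I * c) • ψ' = (U.rescale c).generator ⟨U.op t ψ, h⟩ := by
  set φ := (U.rescale c).generator ⟨ψ, hψ⟩
  have hgraph : (ψ, φ) ∈ (U.rescale c).generator.graph := LinearPMap.mem_graph _ ⟨ψ, hψ⟩
  have hop : (U.op t ψ, U.op t φ) ∈ (U.rescale c).generator.graph := by
    simpa only [U.rescale_op_div hc] using op_mem_generator_graph hgraph (t / c)
  have hU : (ψ, c⁻¹ • φ) ∈ U.generator.graph :=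
    mem_generator_graph_of_rescale hc (by rwa [smul_inv_smul₀ hc])
  have hmem := LinearPMap.mem_domain_of_mem_graph hop
  have hval : (U.rescale c).generator ⟨U.op t ψ, hmem⟩ = U.op t φ :=
    LinearPMap.mem_graph_snd_inj _ (LinearPMap.mem_graph _ ⟨U.op t ψ, hmem⟩) hop rfl
  have hscalar : Complex.I * c * -(Complex.I * (c⁻¹ : ℝ)) = 1 := by
    have hc' : (c : ℂ) ≠ 0 := Complex.ofReal_ne_zero.2 hc
    push_cast
    field_simp
    simp
  refine ⟨hmem, _, hasDerivAt_op_of_mem_graph hU t, ?_⟩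
  rw [hval, ← Complex.coe_smul, map_smul, smul_smul, ← neg_smul, smul_smul, hscalar, one_smul]

end OneParameterUnitaryGroup

section Extension

variable {E H : Type*} [AddCommGroup E] [Module ℂ E] [NormedAddCommGroup H]
  [InnerProductSpace ℂ H] {Υ : E →ₗ[ℂ] H} {T : ℝ → E →ₗ[ℂ] E}

/-- `T` is a strongly continuous one-parameter group of isometries of `E`, for the seminorm
`X ↦ ‖Υ X‖` induced by the representation `Υ` of `E` in `H`. -/
structure IsIsometricGroup (Υ : E →ₗ[ℂ] H) (T : ℝ → E →ₗ[ℂ] E) : Prop where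
  map_zero : ∀ X, T 0 X = X
  map_add : ∀ s t X, T (s + t) X = T s (T t X)
  norm_map : ∀ t X, ‖Υ (T t X)‖ = ‖Υ X‖
  tendsto_zero : ∀ X, Tendsto (fun t => Υ (T t X)) (𝓝 0) (𝓝 (Υ X))

namespace IsIsometricGroup

theorem continuous (hT : IsIsometricGroup Υ T) (X : E) : Continuous fun t => Υ (T t X) := by
  refine continuous_iff_continuousAt.2 fun t => ?_
  have hsub : Tendsto (fun s : ℝ => s - t) (𝓝 t) (𝓝 0) := by
    simpa using (continuous_sub_right t).tendsto t
  refine ((hT.tendsto_zero (T t X)).comp hsub).congr fun s => ?_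
  rw [Function.comp_apply, ← hT.map_add, sub_add_cancel]

theorem exists_extension [CompleteSpace H] (hT : IsIsometricGroup Υ T) (hΥ : DenseRange Υ) :
    ∃ U : OneParameterUnitaryGroup H, ∀ t X, U.op t (Υ X) = Υ (T t X) := by
  have hinv : ∀ t, T t ∘ₗ T (-t) = LinearMap.id := fun t => LinearMap.ext fun X => by
    rw [LinearMap.comp_apply, ← hT.map_add, add_neg_cancel, hT.map_zero, LinearMap.id_apply]
  let e (t : ℝ) : E ≃ₗ[ℂ] E := .ofLinearMap (T t) (T (-t)) (hinv t) (by simpa using hinv (-t))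
  let op (t : ℝ) : H ≃ₗᵢ[ℂ] H := (e t).extendOfIsometry Υ Υ hΥ hΥ (hT.norm_map t)
  have hop : ∀ t X, op t (Υ X) = Υ (T t X) := fun t => LinearEquiv.extendOfIsometry_eq _ _ _ _ _ _
  refine ⟨⟨op, fun s t ψ => ?_, fun ψ => ?_⟩, hop⟩
  · refine hΥ.induction_on ψ (isClosed_eq (by fun_prop) (by fun_prop)) fun X => ?_
    simp only [hop, hT.map_add]
  · refine continuous_iff_continuousAt.2 fun t => ?_
    refine tendsto_of_dense_of_lipschitzWith (fun s => (op s).lipschitz) (op t).continuous hΥ ?_ ψ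
    rintro _ ⟨X, rfl⟩
    simpa only [hop] using (hT.continuous X).tendsto t

end IsIsometricGroup

end Extension

section Geometry

variable {M : Type*} [TopologicalSpace M]
  [ChartedSpace (EuclideanSpace ℝ (Fin 4)) M] [IsManifold (𝓡 4) ∞ M]
  {U : Spacetime M} {S : Type*} [TopologicalSpace S]
  [ChartedSpace (EuclideanSpace ℝ (Fin 3)) S] [IsManifold (𝓡 3) ∞ S]
  {S₀ : SpacelikeHypersurface U S}
  {V : Type*} [NormedAddCommGroup V] [NormedSpace ℂ V]
  {F : M → Type*} [TopologicalSpace (TotalSpace V F)]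
  [∀ m, AddCommGroup (F m)] [∀ m, Module ℂ (F m)]
  {G : GaussianChart S₀} {e : Trivialization V (π V F)} [e.IsLinear ℂ] {he : G.region ⊆ e.baseSet}

theorem reading_eq_reading_zero (θ : ℝ) (X : ∀ m : G.region, F m) (x : G.domain) (t : ℝ) :
    reading G e he θ X x t = reading G e he 0 X x (t - θ) := by
  have hevent : G.event θ x t = G.event 0 x (t - θ) := by simp [GaussianChart.event]
  exact congrArg (fun m : G.region => e.linearEquivAt ℂ (m : M) (he m.2) (X m)) hevent

theorem reading_zero_injective : Function.Injective (reading G e he 0) := by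
  intro X Y h
  funext m
  have hread : reading G e he 0 X (G.place m) (G.time m) =
    reading G e he 0 Y (G.place m) (G.time m) := by rw [h]
  have hevent := (e.linearEquivAt ℂ _ (he (G.event 0 (G.place m) (G.time m)).2)).injective hread
  rwa [G.event_place_time m] at hevent

variable {H : Type*} [NormedAddCommGroup H] [InnerProductSpace ℂ H]

/-- The gauge transformation `U(θ)` on the space `E` of variables of a model. -/
noncomputable def Model.translation (P : Model G e he H) (θ : ℝ) :
    P.sectionSpace →ₗ[ℂ] P.sectionSpace :=
  (translate G e he θ).restrict (P.translate_mem θ)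

theorem Model.inner_translation (P : Model G e he H) (θ : ℝ) (X Y : P.sectionSpace) :
    ⟪P.linearChart (P.translation θ X), P.linearChart (P.translation θ Y)⟫_ℂ =
      ⟪P.linearChart X, P.linearChart Y⟫_ℂ := by
  have hmeasure : ∀ ψ, P.translation θ (P.measure 0 ψ) = P.measure θ ψ := fun ψ =>
    Subtype.ext (P.measure_gauge θ ψ).symm
  refine inner_map_map_of_span_eq_top (f := P.linearChart ∘ₗ P.translation θ) P.measure_span ?_ X Y
  rintro _ ⟨ψ₁, rfl⟩ _ ⟨ψ₂, rfl⟩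
  simp only [LinearMap.comp_apply, hmeasure, P.measure_kernel]

variable [∀ m, TopologicalSpace (F m)]

theorem translate_zero (X : ∀ m : G.region, F m) : translate G e he 0 X = X :=
  reading_zero_injective <| funext₂ fun x t => reading_translate G e he 0 X x t

theorem translate_add (θ θ' : ℝ) (X : ∀ m : G.region, F m) :
    translate G e he (θ + θ') X = translate G e he θ (translate G e he θ' X) := by
  refine reading_zero_injective (e := e) (he := he) <| funext₂ fun x t => ?_
  rw [reading_translate, reading_translate, reading_eq_reading_zero,
    reading_eq_reading_zero θ, reading_translate, reading_eq_reading_zero θ', sub_sub]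

theorem Model.isIsometricGroup_translation (P : Model G e he H) :
    IsIsometricGroup P.linearChart P.translation where
  map_zero X := Subtype.ext (translate_zero (e := e) (he := he) (X : ∀ m : G.region, F m))
  map_add θ θ' X := Subtype.ext (translate_add (e := e) (he := he) θ θ' (X : ∀ m : G.region, F m))
  norm_map θ X := by simp only [norm_eq_sqrt_re_inner (𝕜 := ℂ), P.inner_translation]
  tendsto_zero := P.translate_continuous

theorem Model.evolution_zero (P : Model G e he H) (X : P.sectionSpace) :
    P.evolution X 0 = P.linearChart X :=
  congrArg P.linearChart (P.isIsometricGroup_translation.map_zero X)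

end Geometry

end TimeTranslation

theorem proposition22_general {hbar : ℝ} (hbar_ne : hbar ≠ 0)
    {E H : Type*} [AddCommGroup E] [Module ℂ E]
    [NormedAddCommGroup H] [InnerProductSpace ℂ H] [CompleteSpace H]
    {Υ : E →ₗ[ℂ] H} (hΥ : DenseRange Υ) {T : ℝ → E →ₗ[ℂ] E}
    (hT : TimeTranslation.IsIsometricGroup Υ T) :
    ∃ (Uhat : ℝ → H ≃ₗᵢ[ℂ] H) (Ham : H →ₗ.[ℂ] H),
      (∀ (θ : ℝ) (X : E), Uhat θ (Υ X) = Υ (T θ X)) ∧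
      Uhat 0 = LinearIsometryEquiv.refl ℂ H ∧
      (∀ (θ θ' : ℝ) (ψ : H), Uhat (θ + θ') ψ = Uhat θ (Uhat θ' ψ)) ∧
      (∀ ψ : H, Continuous fun θ : ℝ => Uhat θ ψ) ∧
      IsSelfAdjoint Ham ∧
      (∀ t : ℝ, TimeTranslation.IsExp Ham ((t : ℂ) / (Complex.I * (hbar : ℂ)))
        (Uhat t : H →L[ℂ] H)) ∧
      (∀ ψ₀ ∈ Ham.domain, ∀ t : ℝ, ∃ (h : Uhat t ψ₀ ∈ Ham.domain) (ψ' : H),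
        HasDerivAt (fun s : ℝ => Uhat s ψ₀) ψ' t ∧
          (Complex.I * (hbar : ℂ)) • ψ' = Ham ⟨Uhat t ψ₀, h⟩) := by
  obtain ⟨U, hU⟩ := hT.exists_extension hΥ
  exact ⟨U.op, (U.rescale hbar).generator, hU, LinearIsometryEquiv.ext U.op_zero, U.op_add,
    U.continuous_op, (U.rescale hbar).isSelfAdjoint_generator,
    U.isExp_generator_rescale hbar_ne, fun _ hψ => U.schrodinger_rescale hbar_ne hψ⟩

theorem proposition22
    (hbar : ℝ) (hbar_pos : 0 < hbar)
    {M : Type*} [TopologicalSpace M] [T2Space M]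
    [ChartedSpace (EuclideanSpace ℝ (Fin 4)) M] [IsManifold (𝓡 4) ∞ M]
    {U : TimeTranslation.Spacetime M}
    {S : Type*} [TopologicalSpace S]
    [ChartedSpace (EuclideanSpace ℝ (Fin 3)) S] [IsManifold (𝓡 3) ∞ S]
    {S₀ : TimeTranslation.SpacelikeHypersurface U S}
    (G : TimeTranslation.GaussianChart S₀)
    {V : Type*} [NormedAddCommGroup V] [NormedSpace ℂ V]
    {F : M → Type*} [TopologicalSpace (TotalSpace V F)]
    [∀ m, AddCommGroup (F m)] [∀ m, Module ℂ (F m)] [∀ m, TopologicalSpace (F m)]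
    [FiberBundle V F] [VectorBundle ℂ V F]
    (e : Trivialization V (π V F)) [e.IsLinear ℂ] (he : G.region ⊆ e.baseSet)
    {H : Type*} [NormedAddCommGroup H] [InnerProductSpace ℂ H] [CompleteSpace H]
    (P : TimeTranslation.Model G e he H) :
    ∃ (Uhat : ℝ → H ≃ₗᵢ[ℂ] H) (Ham : H →ₗ.[ℂ] H),
      (∀ (θ : ℝ) (X : P.sectionSpace), Uhat θ (P.linearChart X) =
        P.linearChart ⟨TimeTranslation.translate G e he θ X, P.translate_mem θ X X.2⟩) ∧
      Uhat 0 = LinearIsometryEquiv.refl ℂ H ∧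
      (∀ (θ θ' : ℝ) (ψ : H), Uhat (θ + θ') ψ = Uhat θ (Uhat θ' ψ)) ∧
      (∀ ψ : H, Continuous fun θ : ℝ => Uhat θ ψ) ∧
      IsSelfAdjoint Ham ∧
      (∀ t : ℝ, TimeTranslation.IsExp Ham ((t : ℂ) / (Complex.I * (hbar : ℂ)))
        (Uhat t : H →L[ℂ] H)) ∧
      (∀ (X : P.sectionSpace) (t : ℝ), P.evolution X t = Uhat t (P.evolution X 0)) ∧
      (∀ ψ₀ ∈ Ham.domain, ∀ t : ℝ, ∃ (h : Uhat t ψ₀ ∈ Ham.domain) (ψ' : H),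
        HasDerivAt (fun s : ℝ => Uhat s ψ₀) ψ' t ∧
          (Complex.I * (hbar : ℂ)) • ψ' = Ham ⟨Uhat t ψ₀, h⟩) := by
  obtain ⟨Uhat, Ham, hΥ, hzero, hadd, hcont, hself, hexp, hschr⟩ :=
    proposition22_general hbar_pos.ne' P.linearChart_dense P.isIsometricGroup_translation
  exact ⟨Uhat, Ham, hΥ, hzero, hadd, hcont, hself, hexp,
    fun X t => ((hΥ t X).symm.trans (congrArg (Uhat t) (P.evolution_zero X).symm)), hschr⟩
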